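/- Let $L,M\ge 1$ be integers, let $\Lambda=\{-L,\dots,-1,1\}$, and let $\nu$ and $q_1,\dots,q_M$ be probability measures on $\Lambda$ such that $\nu$ has zero mean and, for each $j$, $q_j$ has positive mean and $q_j(1)<1$. Put $\omega(j,\cdot)=q_j$ for $1\le j\le M$ and $\omega(j,\cdot)=\nu$ for $j>M$. Let $X=(X_n)_{n\ge 0}$ be the $(L,1)$-excited random walk on $\mathbb Z$: $X_0=0$ and, with $(\mathcal F_n)_{n\ge0}$ the natural filtration of $X$, $$\mathbb P(X_{n+1}=X_n+i\mid \mathcal F_n)=\omega\big(\#\{0\le k\le n: X_k=X_n\},\,i\big)\quad\text{a.s. for all } n\ge 0,\ i\in\Lambda .$$ Assume that $X$ is transient to the right, that is, $X_n\to+\infty$ almost surely. For $n\ge 0$ let $T_n=\inf\{k\ge 0: X_k=n\}$, and for $i\le n-1$ let $V_i^n=(V_{i,1}^n,\dots,V_{i,L}^n)$ with $$V_{i,\ell}^n=\sum_{k=0}^{T_n-1}\mathbf 1_{\{X_k>i,\ X_{k+1}=i-\ell+1\}},\qquad 1\le \ell\le L .$$ Let $(\xi_k)_{k\ge1}$ be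 independent random vectors with values in the standard basis $\{\mathbf e_1,\dots,\mathbf e_{L+1}\}$ of $\mathbb R^{L+1}$, with $\mathbb P(\xi_k=\mathbf e_\ell)=\omega(k,-\ell)$ for $1\le\ell\le L$ and $\mathbb P(\xi_k=\mathbf e_{L+1})=\omega(k,1)$. For $m\ge0$ let $\gamma_m=\inf\{n\ge1:\sum_{i=1}^n\xi_{i,L+1}=m+1\}$ and $A(m)=(A_1(m),\dots,A_L(m))$ with $A_\ell(m)=\sum_{i=1}^{\gamma_m}\xi_{i,\ell}$. Let $(A^{(n)}(m))_{m\ge0}$, $n\ge1$, be i.i.d. copies of the process $(A(m))_{m\ge0}$, and define $Z=(Z_n)_{n\ge0}$ with values in $\mathbb Z_+^L$ by $Z_0=(0,\dots,0)$ and, for $n\ge1$, $$Z_n=A^{(n)}(|Z_{n-1}|)+(Z_{n-1,2},Z_{n-1,3},\dots,Z_{n-1,L},0),\qquad |z|=z_1+\dots+z_L .$$ Then for each $n\ge1$ the random vector $(V_{n-1}^n,V_{n-2}^n,\dots,V_0^n)$ has the same distribution as $(Z_0,Z_1,\dots,Z_{n-1})$. -/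

import Mathlib

open MeasureTheory ProbabilityTheory Filter

namespace ExcitedWalk

noncomputable section

/-- The set `Λ = {-L, …, -1, 1}` of allowed steps. -/
def steps (L : ℕ) : Finset ℤ := (Finset.Icc (-(L : ℤ)) 1).erase 0

/-- `p` is a probability measure on `Λ`. -/
def IsStepLaw (L : ℕ) (p : PMF ℤ) : Prop := ∀ i : ℤ, i ∉ steps L → p i = 0

/-- The mean of a probability measure on `Λ`. -/
def stepMean (L : ℕ) (p : PMF ℤ) : ℝ := ∑ i ∈ steps L, (i : ℝ) * (p i).toReal

/-- The cookie environment: the law of the step taken at the `j`-th visit (`j ≥ 1`) to a site is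
`q j` if `1 ≤ j ≤ M`, and `ν` if `j > M`. (The value at `j = 0` is never used.) -/
def cookieEnv {M : ℕ} (q : Finset.Icc 1 M → PMF ℤ) (ν : PMF ℤ) (j : ℕ) : PMF ℤ :=
  if h : j ∈ Finset.Icc 1 M then q ⟨j, h⟩ else ν

section Walk

variable {Ω : Type*} [MeasurableSpace Ω]

/-- The number of visits of the process `X` to the site `x` up to (and including) time `n`. -/
def visits (X : ℕ → Ω → ℤ) (x : ℤ) (n : ℕ) (ω : Ω) : ℕ :=
  ∑ k ∈ Finset.range (n + 1), if X k ω = x then 1 else 0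

/-- `X` is an `(L,1)`-excited random walk in the cookie environment given by `q` and `ν`: it starts
at `0`, and, given its natural filtration at time `n`, it makes the step `i ∈ Λ` with the probability
that the environment prescribes for the current number of visits to the current position. -/
structure IsExcitedWalk (L : ℕ) {M : ℕ} (q : Finset.Icc 1 M → PMF ℤ) (ν : PMF ℤ)
    (P : Measure Ω) (X : ℕ → Ω → ℤ) : Prop where
  measurable : ∀ n, Measurable (X n)
  start : ∀ᵐ ω ∂P, X 0 ω = 0
  step : ∀ n : ℕ, ∀ i ∈ steps L,
    P[({ω | X (n + 1) ω = X n ω + i}).indicator (fun _ => (1 : ℝ)) |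
        Filtration.natural X (fun k => (measurable k).stronglyMeasurable) n]
      =ᵐ[P] fun ω => (cookieEnv q ν (visits X (X n ω) n ω) i).toReal

/-- The first hitting time `inf {k ≥ 0 : X_k = n}` of the site `n`. (It is `0` by convention if the
site is never hit; this has probability zero for a walk that is transient to the right.) -/
def hittingTime (X : ℕ → Ω → ℤ) (n : ℕ) (ω : Ω) : ℕ := sInf {k : ℕ | X k ω = (n : ℤ)}

/-- The vector `V_i^n`. The types `1, …, L` are indexed by `Fin L`, so that `ℓ : Fin L` stands for the
type `ℓ + 1`: the coordinate `ℓ` counts the jumps, before the hitting time of `n`, from a site in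
`i + ℕ` to the site `i - (ℓ + 1) + 1`. -/
def backwardJumps {L : ℕ} (X : ℕ → Ω → ℤ) (n : ℕ) (i : ℤ) (ω : Ω) : Fin L → ℕ := fun ℓ =>
  ∑ k ∈ Finset.range (hittingTime X n ω),
    if i < X k ω ∧ X (k + 1) ω = i - ((ℓ : ℤ) + 1) + 1 then 1 else 0

end Walk

section Trials

variable {Ω : Type*} [MeasurableSpace Ω]

/-- The step that corresponds to an outcome of an experiment: `-(ℓ + 1)` for the index `ℓ < L` (a
failure of type `ℓ + 1`), and `1` for the last index (a success). -/
def outcomeStep (L : ℕ) (ℓ : Fin (L + 1)) : ℤ := if (ℓ : ℕ) < L then -((ℓ : ℤ) + 1) else 1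

/-- `ξ` is the sequence of independent random unit vectors. Here `ξ n` is the outcome of the
experiment number `n + 1`, so that its law is given by the cookie environment at `n + 1`. -/
structure IsTrialSequence (L : ℕ) {M : ℕ} (q : Finset.Icc 1 M → PMF ℤ) (ν : PMF ℤ)
    (P : Measure Ω) (ξ : ℕ → Ω → Fin (L + 1) → ℕ) : Prop where
  measurable : ∀ n, Measurable (ξ n)
  indep : iIndepFun ξ P
  law : ∀ (n : ℕ) (ℓ : Fin (L + 1)),
    P {ω | ξ n ω = Pi.single ℓ 1} = cookieEnv q ν (n + 1) (outcomeStep L ℓ)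

/-- `γ_m`, the number of experiments needed to obtain `m + 1` successes. (It is `0` by convention if
there is no such number, an event of probability zero when `q_j(1)` and `ν(1)` are positive.) -/
def successTime {L : ℕ} (ξ : ℕ → Ω → Fin (L + 1) → ℕ) (m : ℕ) (ω : Ω) : ℕ :=
  sInf {n : ℕ | 1 ≤ n ∧ ∑ i ∈ Finset.range n, ξ i ω (Fin.last L) = m + 1}

/-- The process `(A(m))_{m ≥ 0}`: the coordinate `ℓ` of `A(m)` is the number of failures of type
`ℓ + 1` before `m + 1` successes are obtained. -/
def failureCount {L : ℕ} (ξ : ℕ → Ω → Fin (L + 1) → ℕ) (ω : Ω) (m : ℕ) : Fin L → ℕ := fun ℓ =>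
  ∑ i ∈ Finset.range (successTime ξ m ω), ξ i ω ℓ.castSucc

end Trials

section Chain

variable {Ω Ω' : Type*} [MeasurableSpace Ω] [MeasurableSpace Ω']

/-- `A 0, A 1, …` are i.i.d. copies, on `(Ω, P)`, of the process `B` on `(Ω', P')`. -/
structure IsIIDCopies {L : ℕ} (P : Measure Ω) (A : ℕ → Ω → ℕ → Fin L → ℕ)
    (P' : Measure Ω') (B : Ω' → ℕ → Fin L → ℕ) : Prop where
  identDistrib : ∀ n, IdentDistrib (A n) B P P'
  indep : iIndepFun A P

/-- The shift `(z_1, …, z_L) ↦ (z_2, …, z_L, 0)`. -/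
def shift {L : ℕ} (z : Fin L → ℕ) : Fin L → ℕ := fun ℓ =>
  if h : (ℓ : ℕ) + 1 < L then z ⟨(ℓ : ℕ) + 1, h⟩ else 0

/-- The process `Z` with initial value `Z₀` and `Z_n = A^{(n)}(|Z_{n-1}|) + shift Z_{n-1}` for
`n ≥ 1`, where `A n` stands for the copy `A^{(n+1)}`. -/
def chain {L : ℕ} (Z₀ : Ω → Fin L → ℕ) (A : ℕ → Ω → ℕ → Fin L → ℕ) : ℕ → Ω → Fin L → ℕ
  | 0 => Z₀
  | n + 1 => fun ω => A n ω (∑ ℓ, chain Z₀ A n ω ℓ) + shift (chain Z₀ A n ω)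

end Chain

end

end ExcitedWalk

/-! Attach to every site an independent stack of steps whose entry number `k` has the law `ω(k,·)`,
and let a path take the next unread entry at the site where it stands. The walk gives a finite path
exactly the probability that the stacks generate it: both are the same product of cookie
probabilities (`IsExcitedWalk.measure_path`, `stackMeasure_followsStack`).

The rest is combinatorics of one path that reads the stacks and stops on hitting `n`. Upward steps
have size one, so the number of steps from `i` to `i + 1`, for `0 ≤ i < n`, is one more than the
number `d` of downcrossings from above `i`. Hence the part of the stack at `i` that is read ends
exactly at its success number `d + 1`, and the failures in it are the jumps downwards from `i`. The
jumps over `i - 1` are these together with the jumps from above `i` that land below `i`, which are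
the shifted vector of `i`. Since `d` is the sum of that vector, this is the recursion of `Z`
(`FollowsStack.jumpVector_sub_one`), with counts taken from the independent stacks at `n - 1, n - 2,
…`.

To transfer laws, sum over the countably many paths from `0` that stop on hitting `n`. Almost surely
the walk follows one of them, so each value of the jump vectors is at most as likely as the same
value of the stack chain. Both laws are probability measures on a countable space, hence equal
(`IsExcitedWalk.map_backwardJumps_eq`). -/

namespace ExcitedWalk

/-! ### Combinatorics of paths that read stacks -/

section Deterministic

/-- The number of visits of the path `y` to the site `i` strictly before time `t`. -/
def localTime (y : ℕ → ℤ) (i : ℤ) (t : ℕ) : ℕ :=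
  ∑ k ∈ Finset.range t, if y k = i then 1 else 0

/-- All the steps of `y` up to time `t` are allowed. -/
def IsPath (L : ℕ) (y : ℕ → ℤ) (t : ℕ) : Prop := ∀ k < t, y (k + 1) - y k ∈ steps L

/-- Up to time `t`, the path `y` reads its steps from the stacks `s`: at the visit number `k + 1`
to the site `i` it makes the step `s i k`. -/
def FollowsStack (y : ℕ → ℤ) (s : ℤ → ℕ → ℤ) (t : ℕ) : Prop :=
  ∀ k < t, s (y k) (localTime y (y k) k) = y (k + 1) - y k

/-- The number of jumps of `y` before time `t` from a site above `i` to a site at most `i`. -/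
def downcrossings (y : ℕ → ℤ) (i : ℤ) (t : ℕ) : ℕ :=
  ∑ k ∈ Finset.range t, if i < y k ∧ y (k + 1) ≤ i then 1 else 0

/-- The numbers of jumps of `y` before time `t` from a site above `i` to `i, i - 1, …`. -/
def jumpVector {L : ℕ} (y : ℕ → ℤ) (t : ℕ) (i : ℤ) : Fin L → ℕ := fun ℓ =>
  ∑ k ∈ Finset.range t, if i < y k ∧ y (k + 1) = i - ((ℓ : ℤ) + 1) + 1 then 1 else 0

/-- The outcome of an experiment that corresponds to a step. -/
def encode (L : ℕ) (d : ℤ) : Fin (L + 1) → ℕ := fun ℓ => if d = outcomeStep L ℓ then 1 else 0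

/-- The outcomes read from the stack at the site `i`. -/
def siteTrials (L : ℕ) (i : ℤ) : ℕ → (ℤ → ℕ → ℤ) → Fin (L + 1) → ℕ := fun k s => encode L (s i k)

theorem mem_steps {L : ℕ} {d : ℤ} : d ∈ steps L ↔ d ≠ 0 ∧ -(L : ℤ) ≤ d ∧ d ≤ 1 := by
  simp [steps]

theorem localTime_succ (y : ℕ → ℤ) (i : ℤ) (t : ℕ) :
    localTime y i (t + 1) = localTime y i t + if y t = i then 1 else 0 :=
  Finset.sum_range_succ _ _

theorem localTime_congr {x y : ℕ → ℤ} {t : ℕ} (h : ∀ k < t, x k = y k) (i : ℤ) :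
    localTime x i t = localTime y i t :=
  Finset.sum_congr rfl fun k hk => by rw [h k (Finset.mem_range.1 hk)]

theorem exists_localTime_eq {y : ℕ → ℤ} {i : ℤ} {m t : ℕ} (h : m < localTime y i t) :
    ∃ k < t, y k = i ∧ localTime y i k = m := by
  induction t with
  | zero => simp [localTime] at h
  | succ t ih =>
    by_cases hm : m < localTime y i t
    · obtain ⟨k, hk, h'⟩ := ih hm
      exact ⟨k, by omega, h'⟩
    · rw [localTime_succ] at h
      split_ifs at h with hy
      · exact ⟨t, by omega, hy, by omega⟩
      · omega

theorem FollowsStack.mono {y : ℕ → ℤ} {s : ℤ → ℕ → ℤ} {t u : ℕ} (h : FollowsStack y s t)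
    (hu : u ≤ t) : FollowsStack y s u := fun k hk => h k (by omega)

/-- Sums over the part of the stack at `i` that has been read are sums over the visits to `i`. -/
theorem FollowsStack.sum_eq {y : ℕ → ℤ} {s : ℤ → ℕ → ℤ} {t : ℕ} (h : FollowsStack y s t) (i : ℤ)
    (g : ℤ → ℕ) :
    ∑ m ∈ Finset.range (localTime y i t), g (s i m) =
      ∑ k ∈ Finset.range t, if y k = i then g (y (k + 1) - y k) else 0 := by
  induction t with
  | zero => simp [localTime]
  | succ t ih =>
    rw [localTime_succ, Finset.sum_range_succ _ t, ← ih (h.mono t.le_succ)]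
    split_ifs with hy
    · rw [Finset.sum_range_succ, ← h t t.lt_succ_self, hy]
    · simp

/-- Two paths with the same start that read the same stacks agree. -/
theorem FollowsStack.eq {x y : ℕ → ℤ} {s : ℤ → ℕ → ℤ} {t u : ℕ} (hx : FollowsStack x s t)
    (hy : FollowsStack y s u) (h0 : x 0 = y 0) (k : ℕ) (hk : k ≤ t) (hk' : k ≤ u) : x k = y k := by
  induction k using Nat.strong_induction_on with
  | _ k ih =>
    cases k with
    | zero => exact h0
    | succ k =>
      have hlt : ∀ j < k, x j = y j := fun j hj => ih j (by omega) (by omega) (by omega)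
      have hk0 : x k = y k := ih k (by omega) (by omega) (by omega)
      have h1 := hx k (by omega)
      have h2 := hy k (by omega)
      rw [localTime_congr hlt, hk0] at h1
      linarith

theorem downcrossings_mono (y : ℕ → ℤ) (i : ℤ) : Monotone (downcrossings y i) := fun _ _ h =>
  Finset.sum_le_sum_of_subset (Finset.range_mono h)

/-- A path can rise above `i` only by a step from `i` to `i + 1`. As it starts at or below `i`,
upcrossings and downcrossings alternate, beginning with an upcrossing. -/
theorem upcrossings_eq {L : ℕ} {y : ℕ → ℤ} {t : ℕ} (hy : IsPath L y t) {i : ℤ} (h0 : y 0 ≤ i) :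
    (∑ k ∈ Finset.range t, if y k = i then (if y (k + 1) - y k = 1 then 1 else 0) else 0) =
      downcrossings y i t + if i < y t then 1 else 0 := by
  induction t with
  | zero => simp [downcrossings, h0]
  | succ t ih =>
    have h := mem_steps.1 (hy t t.lt_succ_self)
    rw [downcrossings, Finset.sum_range_succ, Finset.sum_range_succ,
      ih fun k hk => hy k (by omega)]
    rw [← downcrossings]
    split_ifs <;> omega

theorem outcomeStep_last (L : ℕ) : outcomeStep L (Fin.last L) = 1 := by simp [outcomeStep]

theorem outcomeStep_castSucc {L : ℕ} (ℓ : Fin L) :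
    outcomeStep L ℓ.castSucc = -((ℓ : ℤ) + 1) := by simp [outcomeStep]

theorem FollowsStack.sum_siteTrials_last {L : ℕ} {y : ℕ → ℤ} {s : ℤ → ℕ → ℤ} {t : ℕ}
    (h : FollowsStack y s t) (hy : IsPath L y t) {i : ℤ} (h0 : y 0 ≤ i) :
    ∑ m ∈ Finset.range (localTime y i t), siteTrials L i m s (Fin.last L) =
      downcrossings y i t + if i < y t then 1 else 0 := by
  rw [← upcrossings_eq hy h0]
  simp only [siteTrials, encode, outcomeStep_last]
  exact h.sum_eq i fun d => if d = 1 then 1 else 0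

/-- Before a path that reads the stacks ends above `i`, it visits `i` until the number of upward
steps from `i` exceeds the number of downcrossings by one. -/
theorem FollowsStack.successTime_eq {L : ℕ} {y : ℕ → ℤ} {s : ℤ → ℕ → ℤ} {t : ℕ}
    (h : FollowsStack y s t) (hy : IsPath L y t) {i : ℤ} (h0 : y 0 ≤ i) (ht : i < y t) :
    successTime (siteTrials L i) (downcrossings y i t) s = localTime y i t := by
  have hsum := h.sum_siteTrials_last hy h0
  rw [if_pos ht] at hsum
  refine le_antisymm (Nat.sInf_le ⟨Nat.one_le_iff_ne_zero.2 fun h => ?_, hsum⟩)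
    (le_csInf ⟨localTime y i t, Nat.one_le_iff_ne_zero.2 fun h => ?_, hsum⟩ ?_)
  · rw [h] at hsum; simp at hsum
  · rw [h] at hsum; simp at hsum
  · rintro m ⟨-, hm⟩
    by_contra! hlt
    -- A shorter prefix of the stack is what has been read at some earlier visit to `i`, at time
    -- `u`. The path is then not above `i`, so the successes so far equal the downcrossings so far,
    -- which are too few.
    obtain ⟨u, hu, hui, rfl⟩ := exists_localTime_eq hlt
    rw [(h.mono hu.le).sum_siteTrials_last (fun k hk => hy k (by omega)) h0, if_neg (by omega)]
      at hm
    have := downcrossings_mono y i hu.le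
    omega

/-- A jump of length at most `L` from above `i` to a site at most `i` lands in `{i - L + 1, …, i}`,
so each downcrossing has exactly one type. -/
theorem sum_jumpVector {L : ℕ} {y : ℕ → ℤ} {t : ℕ} (hy : IsPath L y t) (i : ℤ) :
    ∑ ℓ : Fin L, jumpVector y t i ℓ = downcrossings y i t := by
  simp only [jumpVector]
  rw [Finset.sum_comm, downcrossings]
  refine Finset.sum_congr rfl fun k hk => ?_
  have h := mem_steps.1 (hy k (Finset.mem_range.1 hk))
  split_ifs with hc
  · rw [Finset.sum_eq_single (⟨(i - y (k + 1)).toNat, by omega⟩ : Fin L)]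
    · rw [if_pos]
      refine ⟨hc.1, ?_⟩
      dsimp only
      omega
    · intro ℓ _ hℓ
      rw [if_neg]
      rintro ⟨-, h2⟩
      apply hℓ
      ext
      dsimp only
      omega
    · simp
  · refine Finset.sum_eq_zero fun ℓ _ => if_neg ?_
    rintro ⟨h1, h2⟩
    omega

theorem FollowsStack.failureCount_eq {L : ℕ} {y : ℕ → ℤ} {s : ℤ → ℕ → ℤ} {t : ℕ}
    (h : FollowsStack y s t) (hy : IsPath L y t) {i : ℤ} (h0 : y 0 ≤ i) (ht : i < y t)
    (ℓ : Fin L) :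
    failureCount (siteTrials L i) s (downcrossings y i t) ℓ =
      ∑ k ∈ Finset.range t, if y k = i ∧ y (k + 1) = i - ((ℓ : ℤ) + 1) then 1 else 0 := by
  rw [failureCount, h.successTime_eq hy h0 ht]
  simp only [siteTrials, encode, outcomeStep_castSucc]
  rw [h.sum_eq i fun d => if d = -((ℓ : ℤ) + 1) then 1 else 0]
  refine Finset.sum_congr rfl fun k _ => ?_
  split_ifs <;> omega

/-- The jumps over `i - 1` are the jumps from `i` and those from above `i`. -/
theorem FollowsStack.jumpVector_sub_one {L : ℕ} {y : ℕ → ℤ} {s : ℤ → ℕ → ℤ} {t : ℕ}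
    (h : FollowsStack y s t) (hy : IsPath L y t) {i : ℤ} (h0 : y 0 ≤ i) (ht : i < y t) :
    (jumpVector y t (i - 1) : Fin L → ℕ) =
      failureCount (siteTrials L i) s (∑ ℓ, (jumpVector y t i : Fin L → ℕ) ℓ) +
        shift (jumpVector y t i) := by
  ext ℓ
  rw [sum_jumpVector hy, Pi.add_apply, h.failureCount_eq hy h0 ht, shift]
  split_ifs with hℓ
  -- The landing site `i - 1 - ℓ` (with `ℓ` from `0`) is reached either from `i`, by a failure of
  -- type `ℓ + 1`, or from above `i`, by a jump counted in coordinate `ℓ + 1` at `i`.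
  · simp only [jumpVector]
    rw [← Finset.sum_add_distrib]
    refine Finset.sum_congr rfl fun k _ => ?_
    push_cast
    split_ifs <;> omega
  -- Here the landing site is `i - L`, out of reach from above `i`; only jumps from `i` itself
  -- remain.
  · rw [add_zero, jumpVector]
    refine Finset.sum_congr rfl fun k hk => ?_
    have h := mem_steps.1 (hy k (Finset.mem_range.1 hk))
    split_ifs <;> omega

theorem FollowsStack.jumpVector_eq_chain {L n : ℕ} {y : ℕ → ℤ} {s : ℤ → ℕ → ℤ} {t : ℕ}
    (h : FollowsStack y s t) (hy : IsPath L y t) (h0 : y 0 = 0) (hlt : ∀ k < t, y k < n)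
    (ht : y t = n) (j : ℕ) (hj : j < n) :
    (jumpVector y t ((n : ℤ) - 1 - j) : Fin L → ℕ) =
      chain (fun _ _ => 0)
        (fun j s => failureCount (siteTrials L ((n : ℤ) - 1 - j)) s) j s := by
  induction j with
  | zero =>
    ext ℓ
    -- Before hitting `n` the path is never above `n - 1`, so the chain starts at zero.
    refine Finset.sum_eq_zero fun k hk => if_neg fun hc => ?_
    have := hlt k (Finset.mem_range.1 hk)
    omega
  | succ j ih =>
    have e : (n : ℤ) - 1 - (j + 1 : ℕ) = (n : ℤ) - 1 - j - 1 := by push_cast; ring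
    rw [e, h.jumpVector_sub_one hy (by omega) (by omega), ih (by omega)]
    rfl

/-- A path with upward steps of size one that starts below `n` stays below until it hits `n`. -/
theorem IsPath.lt_of_ne {L n t : ℕ} {y : ℕ → ℤ} (hy : IsPath L y t) (h0 : y 0 ≤ n)
    (hne : ∀ k < t, y k ≠ n) (k : ℕ) (hk : k < t) : y k < n := by
  induction k with
  | zero => exact lt_of_le_of_ne h0 (hne 0 hk)
  | succ k ih =>
    have h1 := ih (by omega)
    have h2 := mem_steps.1 (hy k (by omega))
    exact lt_of_le_of_ne (by omega) (hne _ hk)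

theorem exists_eq_of_tendsto {L : ℕ} {y : ℕ → ℤ} (hy : ∀ t, IsPath L y t) (h0 : y 0 = 0)
    (hlim : Tendsto y atTop atTop) (n : ℕ) : ∃ k, y k = n := by
  by_contra! hne
  obtain ⟨k, hk⟩ := (hlim.eventually (eventually_ge_atTop (n : ℤ))).exists
  have := (hy (k + 1)).lt_of_ne (n := n) (by omega) (fun k _ => hne k) k (by omega)
  omega

end Deterministic

end ExcitedWalk

/-! ### Measurability -/

namespace ExcitedWalk

section Measurability

variable {Ω : Type*} [MeasurableSpace Ω]

theorem measurable_sInf_nat {p : ℕ → Ω → Prop} (hp : ∀ n, MeasurableSet {ω | p n ω}) :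
    Measurable fun ω => sInf {n | p n ω} := by
  refine measurable_of_Iic fun m => ?_
  -- Since `sInf ∅ = 0`, the points where no `p k` holds belong to every such preimage.
  have : (fun ω => sInf {n | p n ω}) ⁻¹' Set.Iic m =
      (⋃ k ∈ Finset.range (m + 1), {ω | p k ω}) ∪ ⋂ k, {ω | p k ω}ᶜ := by
    ext ω
    simp only [Set.mem_preimage, Set.mem_Iic, Set.mem_union, Set.mem_iUnion, Finset.mem_range,
      Set.mem_ofPred_eq, Set.mem_iInter, Set.mem_compl_iff, exists_prop]
    constructor
    · intro h
      by_cases hne : {n | p n ω}.Nonempty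
      · exact Or.inl ⟨_, by omega, Nat.sInf_mem hne⟩
      · exact Or.inr fun k hk => hne ⟨k, hk⟩
    · rintro (⟨k, hk, h⟩ | h)
      · exact (Nat.sInf_le h).trans (by omega)
      · have : {n | p n ω} = ∅ := Set.eq_empty_iff_forall_notMem.2 h
        simp [this]
  rw [this]
  exact (Finset.measurableSet_biUnion _ fun k _ => hp k).union
    (MeasurableSet.iInter fun k => (hp k).compl)

theorem measurable_apply_nat {β : Type*} [MeasurableSpace β] {N : Ω → ℕ} (hN : Measurable N)
    {f : ℕ → Ω → β} (hf : ∀ n, Measurable (f n)) : Measurable fun ω => f (N ω) ω := by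
  have : Measurable fun z : ℕ × Ω => f z.1 z.2 := measurable_from_prod_countable_right hf
  exact this.comp (hN.prodMk measurable_id)

theorem measurable_failureCount {L : ℕ} {ξ : ℕ → Ω → Fin (L + 1) → ℕ} (hξ : ∀ n, Measurable (ξ n)) :
    Measurable (failureCount ξ) := by
  have h : ∀ ℓ N, Measurable fun ω => ∑ i ∈ Finset.range N, ξ i ω ℓ := fun ℓ N =>
    Finset.measurable_sum _ fun i _ => (measurable_pi_apply ℓ).comp (hξ i)
  refine measurable_pi_iff.2 fun m => measurable_pi_iff.2 fun ℓ => ?_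
  refine measurable_apply_nat (measurable_sInf_nat fun n => ?_) (h ℓ.castSucc)
  exact (MeasurableSet.const _).inter (h (Fin.last L) n (measurableSet_singleton (m + 1)))

theorem measurable_backwardJumps {L : ℕ} {X : ℕ → Ω → ℤ} (hX : ∀ n, Measurable (X n)) (n : ℕ)
    (i : ℤ) : Measurable fun ω => (backwardJumps X n i ω : Fin L → ℕ) := by
  refine measurable_pi_iff.2 fun ℓ => ?_
  refine measurable_apply_nat (f := fun N ω => ∑ k ∈ Finset.range N,
    if i < X k ω ∧ X (k + 1) ω = i - ((ℓ : ℤ) + 1) + 1 then 1 else 0)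
    (measurable_sInf_nat fun k => hX k (measurableSet_singleton _)) fun N => ?_
  refine Finset.measurable_sum _ fun k _ => Measurable.ite ?_ measurable_const measurable_const
  exact (hX k measurableSet_Ioi).inter (hX (k + 1) (measurableSet_singleton _))

/-- The chain as a function of the sequence of its failure counts. -/
def chainOfCounts (L : ℕ) (j : ℕ) (a : ℕ → ℕ → Fin L → ℕ) : Fin L → ℕ :=
  chain (fun _ _ => 0) (fun n a => a n) j a

theorem measurable_chainOfCounts (L j : ℕ) : Measurable (chainOfCounts L j) := by
  induction j with
  | zero => exact measurable_const
  | succ j ih =>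
    have h1 : Measurable fun a : ℕ → ℕ → Fin L → ℕ => a j (∑ ℓ, chainOfCounts L j a ℓ) :=
      measurable_apply_nat (f := fun m a => a j m)
        (Finset.measurable_sum _ fun ℓ _ => (measurable_pi_apply ℓ).comp ih)
        fun m => (measurable_pi_apply m).comp (measurable_pi_apply j)
    exact h1.add ((measurable_of_countable shift).comp ih)

end Measurability

theorem chain_eq_chainOfCounts {L : ℕ} {Ω : Type*} {Z₀ : Ω → Fin L → ℕ}
    (A : ℕ → Ω → ℕ → Fin L → ℕ) {ω : Ω}
    (h0 : ∀ ℓ, Z₀ ω ℓ = 0) (j : ℕ) : chain Z₀ A j ω = chainOfCounts L j fun n => A n ω := by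
  induction j with
  | zero => exact funext h0
  | succ j ih =>
    change A j ω (∑ ℓ, chain Z₀ A j ω ℓ) + shift (chain Z₀ A j ω) = _
    rw [ih]
    rfl

/-! ### Laws of the chain, of the failure counts and of the stacks -/

section Laws

/-- The chain is determined in law by the law of the counts of which it uses i.i.d. copies. -/
theorem identDistrib_chain {L : ℕ} {Ω Ω' Ω₁ Ω₁' : Type*} [MeasurableSpace Ω] [MeasurableSpace Ω']
    [MeasurableSpace Ω₁] [MeasurableSpace Ω₁'] {P : Measure Ω} {P' : Measure Ω'}
    {P₁ : Measure Ω₁} {P₁' : Measure Ω₁'}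
    {A : ℕ → Ω → ℕ → Fin L → ℕ} {A' : ℕ → Ω' → ℕ → Fin L → ℕ}
    {B : Ω₁ → ℕ → Fin L → ℕ} {B' : Ω₁' → ℕ → Fin L → ℕ}
    (hA : IsIIDCopies P A P₁ B) (hA' : IsIIDCopies P' A' P₁' B') (hB : IdentDistrib B B' P₁ P₁')
    {Z₀ : Ω → Fin L → ℕ} {Z₀' : Ω' → Fin L → ℕ} (h0 : ∀ᵐ ω ∂P, ∀ ℓ, Z₀ ω ℓ = 0)
    (h0' : ∀ᵐ ω ∂P', ∀ ℓ, Z₀' ω ℓ = 0) (n : ℕ) :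
    IdentDistrib (fun ω (j : Fin n) => chain Z₀ A j ω) (fun ω (j : Fin n) => chain Z₀' A' j ω)
      P P' := by
  have hAA : ∀ k, IdentDistrib (A k) (A' k) P P' := fun k =>
    ((hA.identDistrib k).trans hB).trans (hA'.identDistrib k).symm
  have hseq : IdentDistrib (fun ω k => A k ω) (fun ω k => A' k ω) P P' := by
    refine ⟨aemeasurable_pi_iff.2 fun k => (hAA k).aemeasurable_fst,
      aemeasurable_pi_iff.2 fun k => (hAA k).aemeasurable_snd, ?_⟩
    rw [hA.indep.map_fun_eq_infinitePi_map₀' fun k => (hAA k).aemeasurable_fst,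
      hA'.indep.map_fun_eq_infinitePi_map₀' fun k => (hAA k).aemeasurable_snd]
    simp_rw [(hAA _).map_eq]
  have hmeas : Measurable fun (a : ℕ → ℕ → Fin L → ℕ) (j : Fin n) => chainOfCounts L j a :=
    measurable_pi_iff.2 fun j => measurable_chainOfCounts L j
  have hc := hseq.comp hmeas
  have e : ((fun a (j : Fin n) => chainOfCounts L j a) ∘ fun ω k => A k ω) =ᵐ[P]
      fun ω (j : Fin n) => chain Z₀ A j ω := by
    filter_upwards [h0] with ω hω
    exact funext fun j => (chain_eq_chainOfCounts A hω j).symm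
  have e' : ((fun a (j : Fin n) => chainOfCounts L j a) ∘ fun ω k => A' k ω) =ᵐ[P']
      fun ω (j : Fin n) => chain Z₀' A' j ω := by
    filter_upwards [h0'] with ω hω
    exact funext fun j => (chain_eq_chainOfCounts A' hω j).symm
  exact ((IdentDistrib.of_ae_eq hc.aemeasurable_fst e).symm.trans hc).trans
    (IdentDistrib.of_ae_eq hc.aemeasurable_snd e')

theorem outcomeStep_injective {L : ℕ} : Function.Injective (outcomeStep L) := by
  intro a b h
  ext
  simp only [outcomeStep] at h
  split_ifs at h <;> omega

theorem encode_eq_single {L : ℕ} {d : ℤ} {ℓ : Fin (L + 1)} :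
    encode L d = Pi.single ℓ 1 ↔ d = outcomeStep L ℓ := by
  constructor
  · intro h
    have := congrFun h ℓ
    by_contra hd
    simp [encode, hd] at this
  · rintro rfl
    ext k
    simp [encode, Pi.single_apply, outcomeStep_injective.eq_iff, eq_comm]

theorem sum_outcomeStep {β : Type*} [AddCommMonoid β] (L : ℕ) (f : ℤ → β) :
    ∑ ℓ : Fin (L + 1), f (outcomeStep L ℓ) = ∑ i ∈ steps L, f i := by
  refine Finset.sum_bij (fun ℓ _ => outcomeStep L ℓ) (fun ℓ _ => ?_)
    (fun _ _ _ _ h => outcomeStep_injective h) (fun d hd => ?_) fun _ _ => rfl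
  · rw [mem_steps, outcomeStep]
    split_ifs <;> omega
  · rw [mem_steps] at hd
    by_cases h1 : d = 1
    · exact ⟨Fin.last L, Finset.mem_univ _, by rw [outcomeStep_last, h1]⟩
    · refine ⟨⟨(-d - 1).toNat, by omega⟩, Finset.mem_univ _, ?_⟩
      simp only [outcomeStep]
      split_ifs <;> omega

theorem IsStepLaw.sum_eq_one {L : ℕ} {p : PMF ℤ} (hp : IsStepLaw L p) :
    ∑ i ∈ steps L, p i = 1 := by
  rw [← p.tsum_coe, tsum_eq_sum fun i hi => hp i hi]

theorem isStepLaw_cookieEnv {L M : ℕ} {q : Finset.Icc 1 M → PMF ℤ} {ν : PMF ℤ}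
    (hq : ∀ j, IsStepLaw L (q j)) (hν : IsStepLaw L ν) (j : ℕ) :
    IsStepLaw L (cookieEnv q ν j) := by
  unfold cookieEnv
  split_ifs
  exacts [hq _, hν]

/-- The law of a random vector with values in the standard basis is determined by the probabilities
of the basis vectors. -/
theorem map_eq_of_apply_single {Ω Ω' : Type*} [MeasurableSpace Ω] [MeasurableSpace Ω']
    {P : Measure Ω} {P' : Measure Ω'} [IsProbabilityMeasure P] [IsProbabilityMeasure P'] {d : ℕ}
    {f : Ω → Fin d → ℕ} {g : Ω' → Fin d → ℕ} (hf : Measurable f) (hg : Measurable g)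
    (p : Fin d → ENNReal) (hp : ∑ ℓ, p ℓ = 1) (hfp : ∀ ℓ, P {ω | f ω = Pi.single ℓ 1} = p ℓ)
    (hgp : ∀ ℓ, P' {ω | g ω = Pi.single ℓ 1} = p ℓ) : P.map f = P'.map g := by
  have key : ∀ (μ : Measure (Fin d → ℕ)) [IsProbabilityMeasure μ],
      (∀ ℓ, μ {Pi.single ℓ 1} = p ℓ) → μ = ∑ ℓ, p ℓ • Measure.dirac (Pi.single ℓ 1) := by
    intro μ _ hμ
    symm
    have : IsFiniteMeasure (∑ ℓ, p ℓ • Measure.dirac (Pi.single ℓ 1 : Fin d → ℕ)) :=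
      ⟨by simp [hp]⟩
    -- Both measures have mass one, so it is enough that the atoms account for no more than `μ`.
    refine Measure.eq_of_le_of_measure_univ_eq ?_ (by simp [hp])
    refine Measure.le_iff.2 fun s hs => ?_
    have hinj : Function.Injective fun ℓ : Fin d => (Pi.single ℓ 1 : Fin d → ℕ) := by
      intro a b h
      by_contra hab
      have := congrFun h a
      simp [hab] at this
    classical
    calc (∑ ℓ, p ℓ • Measure.dirac (Pi.single ℓ 1 : Fin d → ℕ)) s
        = ∑ ℓ, if (Pi.single ℓ 1 : Fin d → ℕ) ∈ s then p ℓ else 0 := by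
          simp [Measure.dirac_apply' _ hs, Set.indicator_apply]
      _ = ∑ ℓ with (Pi.single ℓ 1 : Fin d → ℕ) ∈ s, μ {Pi.single ℓ 1} := by
          rw [Finset.sum_filter]
          simp [hμ]
      _ = μ (⋃ ℓ ∈ Finset.univ.filter fun ℓ => (Pi.single ℓ 1 : Fin d → ℕ) ∈ s,
            {Pi.single ℓ 1}) := by
          rw [measure_biUnion_finset _ fun _ _ => measurableSet_singleton _]
          intro a _ b _ hab
          simpa using fun h => hab (hinj h)
      _ ≤ μ s := by
          refine measure_mono ?_
          simp
  have := Measure.isProbabilityMeasure_map (μ := P) hf.aemeasurable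
  have := Measure.isProbabilityMeasure_map (μ := P') hg.aemeasurable
  rw [key (P.map f) fun ℓ => ?_, key (P'.map g) fun ℓ => ?_]
  · rw [Measure.map_apply hg (measurableSet_singleton _)]; exact hgp ℓ
  · rw [Measure.map_apply hf (measurableSet_singleton _)]; exact hfp ℓ

/-- Two sequences of independent experiments in the same environment have the same failure counts
in law. -/
theorem IsTrialSequence.identDistrib_failureCount {L M : ℕ} {q : Finset.Icc 1 M → PMF ℤ} {ν : PMF ℤ}
    (hq : ∀ j, IsStepLaw L (q j)) (hν : IsStepLaw L ν)
    {Ω Ω' : Type*} [MeasurableSpace Ω] [MeasurableSpace Ω']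
    {P : Measure Ω} {P' : Measure Ω'} [IsProbabilityMeasure P] [IsProbabilityMeasure P']
    {ξ : ℕ → Ω → Fin (L + 1) → ℕ} {ξ' : ℕ → Ω' → Fin (L + 1) → ℕ}
    (hξ : IsTrialSequence L q ν P ξ) (hξ' : IsTrialSequence L q ν P' ξ') :
    IdentDistrib (failureCount ξ) (failureCount ξ') P P' := by
  have hone : ∀ n, P.map (ξ n) = P'.map (ξ' n) := fun n =>
    map_eq_of_apply_single (hξ.measurable n) (hξ'.measurable n) _
      ((sum_outcomeStep L _).trans (isStepLaw_cookieEnv hq hν (n + 1)).sum_eq_one)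
      (hξ.law n) (hξ'.law n)
  have hseq : IdentDistrib (fun ω n => ξ n ω) (fun ω n => ξ' n ω) P P' := by
    refine ⟨(measurable_pi_iff.2 hξ.measurable).aemeasurable,
      (measurable_pi_iff.2 hξ'.measurable).aemeasurable, ?_⟩
    rw [hξ.indep.map_fun_eq_infinitePi_map hξ.measurable,
      hξ'.indep.map_fun_eq_infinitePi_map hξ'.measurable]
    simp_rw [hone]
  exact hseq.comp (measurable_failureCount
    (ξ := fun n (x : ℕ → Fin (L + 1) → ℕ) => x n) measurable_pi_apply)

/-- The law of independent stacks of steps, one for each site, in the cookie environment. -/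
noncomputable def stackMeasure {M : ℕ} (q : Finset.Icc 1 M → PMF ℤ) (ν : PMF ℤ) :
    Measure (ℤ → ℕ → ℤ) :=
  Measure.infinitePi fun _ : ℤ => Measure.infinitePi fun k : ℕ => (cookieEnv q ν (k + 1)).toMeasure

instance {M : ℕ} (q : Finset.Icc 1 M → PMF ℤ) (ν : PMF ℤ) :
    IsProbabilityMeasure (stackMeasure q ν) := by
  unfold stackMeasure; infer_instance

variable {L M : ℕ} (q : Finset.Icc 1 M → PMF ℤ) (ν : PMF ℤ)

theorem iIndepFun_stack :
    iIndepFun (fun (p : ℤ × ℕ) (s : ℤ → ℕ → ℤ) => s p.1 p.2) (stackMeasure q ν) :=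
  iIndepFun_uncurry_infinitePi' (X := fun _ _ d => d) _ fun _ _ => measurable_id

theorem stackMeasure_apply (i : ℤ) (k : ℕ) (d : ℤ) :
    stackMeasure q ν {s | s i k = d} = cookieEnv q ν (k + 1) d := by
  have h1 : (stackMeasure q ν).map (fun s => s i k) = (cookieEnv q ν (k + 1)).toMeasure := by
    have : (fun s : ℤ → ℕ → ℤ => s i k) = (fun r : ℕ → ℤ => r k) ∘ fun s => s i := rfl
    rw [this, ← Measure.map_map (measurable_pi_apply k) (measurable_pi_apply i), stackMeasure,
      Measure.infinitePi_map_eval, Measure.infinitePi_map_eval]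
  rw [← PMF.toMeasure_apply_singleton _ d (measurableSet_singleton d), ← h1,
    Measure.map_apply (by fun_prop) (measurableSet_singleton d)]
  rfl

theorem isTrialSequence_siteTrials (i : ℤ) :
    IsTrialSequence L q ν (stackMeasure q ν) (siteTrials L i) where
  measurable n := (measurable_of_countable (encode L)).comp (by fun_prop : Measurable
    fun s : ℤ → ℕ → ℤ => s i n)
  indep := ((iIndepFun_stack q ν).precomp (g := fun k : ℕ => (i, k))
    (fun _ _ h => (Prod.ext_iff.1 h).2)).comp (fun _ => encode L)
    fun _ => measurable_of_countable _
  law n ℓ := by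
    rw [← stackMeasure_apply q ν i]
    simp only [siteTrials, encode_eq_single]

/-- Stacks at distinct sites are independent and have the same law, so distinct sites `c j` supply
i.i.d. copies of the failure counts. -/
theorem isIIDCopies_siteTrials {Ω : Type*} [MeasurableSpace Ω] {P : Measure Ω}
    [IsProbabilityMeasure P] {ξ : ℕ → Ω → Fin (L + 1) → ℕ} (hξ : IsTrialSequence L q ν P ξ)
    (hq : ∀ j, IsStepLaw L (q j)) (hν : IsStepLaw L ν) {c : ℕ → ℤ} (hc : Function.Injective c) :
    IsIIDCopies (stackMeasure q ν) (fun j s => failureCount (siteTrials L (c j)) s) P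
      (failureCount ξ) where
  identDistrib j :=
    (isTrialSequence_siteTrials q ν (c j)).identDistrib_failureCount hq hν hξ
  indep := by
    have h : iIndepFun (fun (i : ℤ) (s : ℤ → ℕ → ℤ) => s i) (stackMeasure q ν) :=
      iIndepFun_infinitePi (X := fun _ r => r) fun _ => measurable_id
    refine (h.precomp hc).comp
      (fun _ => failureCount fun k (r : ℕ → ℤ) => encode L (r k)) fun _ => ?_
    exact measurable_failureCount fun k =>
      (measurable_of_countable (encode L)).comp (measurable_pi_apply k)

end Laws

end ExcitedWalk

/-! ### Law of the initial segments of the walk -/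

namespace ExcitedWalk

theorem visits_eq_localTime {Ω : Type*} (X : ℕ → Ω → ℤ) (i : ℤ) (n : ℕ) (ω : Ω) :
    visits X i n ω = localTime (fun k => X k ω) i (n + 1) := rfl

section Walk

variable {L M : ℕ} {q : Finset.Icc 1 M → PMF ℤ} {ν : PMF ℤ} {Ω : Type*} [MeasurableSpace Ω]
  {P : Measure Ω} [IsProbabilityMeasure P] {X : ℕ → Ω → ℤ}

/-- The probability of a step on an event of the past that determines the position and the number
of visits. -/
theorem IsExcitedWalk.measure_inter_step (hX : IsExcitedWalk L q ν P X) {n : ℕ} {C : Set Ω}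
    (hC : MeasurableSet[Filtration.natural X (fun k => (hX.measurable k).stronglyMeasurable) n] C)
    {c : ℕ} (hc : ∀ ω ∈ C, visits X (X n ω) n ω = c) {i : ℤ} (hi : i ∈ steps L) :
    P (C ∩ {ω | X (n + 1) ω = X n ω + i}) = P C * cookieEnv q ν c i := by
  set ℱ := Filtration.natural X (fun k => (hX.measurable k).stronglyMeasurable)
  have hS : MeasurableSet {ω | X (n + 1) ω = X n ω + i} :=
    measurableSet_eq_fun (hX.measurable _) ((hX.measurable _).add_const i)
  have hC' : MeasurableSet C := ℱ.le n _ hC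
  have h1 := setIntegral_condExp (μ := P) (ℱ.le n)
    ((integrable_const (1 : ℝ)).indicator hS) hC
  have h2 : ∫ ω in C, (P[({ω | X (n + 1) ω = X n ω + i}).indicator (fun _ => (1 : ℝ)) | ℱ n]) ω ∂P
      = ∫ ω in C, (cookieEnv q ν c i).toReal ∂P := by
    refine setIntegral_congr_ae hC' ?_
    filter_upwards [hX.step n i hi] with ω hω hωC
    rw [hω, hc ω hωC]
  rw [h2, setIntegral_const, setIntegral_indicator hS, setIntegral_const, smul_eq_mul, smul_eq_mul,
    mul_one] at h1
  rw [← ENNReal.toReal_eq_toReal_iff' (measure_ne_top _ _)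
    (ENNReal.mul_ne_top (measure_ne_top _ _) (PMF.apply_ne_top _ _)), ENNReal.toReal_mul]
  exact h1.symm

/-- The probability of an initial segment of the walk. -/
theorem IsExcitedWalk.measure_path (hX : IsExcitedWalk L q ν P X) {x : ℕ → ℤ} (h0 : x 0 = 0)
    (m : ℕ) (hx : IsPath L x m) :
    P {ω | ∀ k ≤ m, X k ω = x k} =
      ∏ k ∈ Finset.range m, cookieEnv q ν (localTime x (x k) k + 1) (x (k + 1) - x k) := by
  induction m with
  | zero =>
    simp only [Nat.le_zero, forall_eq, h0, Finset.range_zero, Finset.prod_empty]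
    exact (prob_compl_eq_zero_iff (hX.measurable 0 (measurableSet_singleton 0))).1 hX.start
  | succ m ih =>
    rw [Finset.prod_range_succ, ← ih fun k hk => hx k (by omega),
      ← hX.measure_inter_step (n := m) (C := {ω | ∀ k ≤ m, X k ω = x k}) ?_ ?_ (hx m (by omega))]
    · congr 1
      ext ω
      simp only [Set.mem_ofPred_eq, Set.mem_inter_iff]
      constructor
      · intro h
        refine ⟨fun k hk => h k (by omega), ?_⟩
        rw [h m (by omega), h (m + 1) le_rfl]
        ring
      · rintro ⟨h, h'⟩ k hk
        rcases Nat.lt_or_ge m k with hlt | hle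
        · obtain rfl : k = m + 1 := by omega
          rw [h', h m le_rfl]
          ring
        · exact h k hle
    · have : {ω | ∀ k ≤ m, X k ω = x k} = ⋂ k, ⋂ (_ : k ≤ m), X k ⁻¹' {x k} := by
        ext ω
        simp
      rw [this]
      refine MeasurableSet.iInter fun k => MeasurableSet.iInter fun hk => ?_
      have h := (Filtration.natural X fun k => (hX.measurable k).stronglyMeasurable).mono hk
      refine h _ ?_
      exact (Filtration.stronglyAdapted_natural fun k =>
        (hX.measurable k).stronglyMeasurable) k |>.measurable (measurableSet_singleton _)
    · intro ω hω
      -- `visits` includes the present time and `localTime` does not, hence the `+ 1` in the index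
      -- of the cookie.
      rw [visits_eq_localTime, hω m le_rfl, localTime_succ, if_pos (hω m le_rfl)]
      rw [localTime_congr (y := x) fun k hk => hω k hk.le]

/-- The walk makes only allowed steps. -/
theorem IsExcitedWalk.ae_isPath (hX : IsExcitedWalk L q ν P X) (hq : ∀ j, IsStepLaw L (q j))
    (hν : IsStepLaw L ν) : ∀ᵐ ω ∂P, ∀ t, IsPath L (fun k => X k ω) t := by
  have key : ∀ n, ∀ᵐ ω ∂P, X (n + 1) ω - X n ω ∈ steps L := by
    intro n
    set ℱ := Filtration.natural X (fun k => (hX.measurable k).stronglyMeasurable)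
    have hS : ∀ i, MeasurableSet {ω | X (n + 1) ω = X n ω + i} := fun i =>
      measurableSet_eq_fun (hX.measurable _) ((hX.measurable _).add_const i)
    have hm : MeasurableSet {ω | X (n + 1) ω - X n ω ∈ steps L} :=
      ((hX.measurable (n + 1)).sub (hX.measurable n)) (steps L).measurableSet
    have hU : {ω | X (n + 1) ω - X n ω ∈ steps L} =
        ⋃ i ∈ steps L, {ω | X (n + 1) ω = X n ω + i} := by
      ext ω
      simp only [Set.mem_ofPred_eq, Set.mem_iUnion, exists_prop]
      constructor
      · intro h
        exact ⟨_, h, by ring⟩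
      · rintro ⟨i, hi, h⟩
        rw [h]
        simpa using hi
    -- The conditional probabilities are prescribed for allowed steps only, but they already sum to
    -- one.
    have hreal : P.real {ω | X (n + 1) ω - X n ω ∈ steps L} = 1 := by
      calc P.real {ω | X (n + 1) ω - X n ω ∈ steps L}
          = ∑ i ∈ steps L, P.real {ω | X (n + 1) ω = X n ω + i} := by
            rw [hU, measureReal_biUnion_finset _ fun i _ => hS i]
            intro i _ j _ hij
            refine Set.disjoint_left.2 fun ω hi hj => hij ?_
            have h : X n ω + i = X n ω + j := hi.symm.trans hj
            exact add_left_cancel h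
        _ = ∑ i ∈ steps L, ∫ ω,
              (P[({ω | X (n + 1) ω = X n ω + i}).indicator (fun _ => (1 : ℝ)) | ℱ n]) ω ∂P := by
            refine Finset.sum_congr rfl fun i _ => ?_
            rw [integral_condExp (ℱ.le n), integral_indicator_const _ (hS i), smul_eq_mul, mul_one]
        _ = ∫ ω, ∑ i ∈ steps L,
              (P[({ω | X (n + 1) ω = X n ω + i}).indicator (fun _ => (1 : ℝ)) | ℱ n]) ω ∂P :=
            (integral_finsetSum _ fun i _ => integrable_condExp).symm
        _ = ∫ _, (1 : ℝ) ∂P := by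
            refine integral_congr_ae ?_
            filter_upwards [(Finset.eventually_all (steps L)).2 fun i hi => hX.step n i hi]
              with ω hω
            rw [Finset.sum_congr rfl hω, ← ENNReal.toReal_sum fun i _ => PMF.apply_ne_top _ _,
              (isStepLaw_cookieEnv hq hν _).sum_eq_one, ENNReal.toReal_one]
        _ = 1 := by simp
    rw [measureReal_def, ENNReal.toReal_eq_one_iff] at hreal
    exact (prob_compl_eq_zero_iff hm).2 hreal
  filter_upwards [ae_all_iff.2 key] with ω hω t k _
  exact hω k

end Walk

/-! ### Comparison of the walk with the stacks -/

theorem stackMeasure_followsStack {M : ℕ} (q : Finset.Icc 1 M → PMF ℤ) (ν : PMF ℤ) (x : ℕ → ℤ)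
    (m : ℕ) :
    stackMeasure q ν {s | FollowsStack x s m} =
      ∏ k ∈ Finset.range m, cookieEnv q ν (localTime x (x k) k + 1) (x (k + 1) - x k) := by
  -- No stack entry is read twice, since each visit raises the local time. The entries read along
  -- `x` are therefore independent.
  have hinj : Function.Injective fun k => (x k, localTime x (x k) k) := by
    have aux : ∀ a b, a < b → (x a, localTime x (x a) a) ≠ (x b, localTime x (x b) b) := by
      intro a b hab h
      obtain ⟨h1, h2⟩ := Prod.ext_iff.1 h
      dsimp only at h1 h2
      have h3 : localTime x (x a) (a + 1) ≤ localTime x (x a) b :=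
        Finset.sum_le_sum_of_subset (Finset.range_mono hab)
      rw [localTime_succ, if_pos rfl, h2, h1] at h3
      omega
    intro a b h
    rcases lt_trichotomy a b with hab | hab | hab
    · exact absurd h (aux a b hab)
    · exact hab
    · exact absurd h.symm (aux b a hab)
  have h := ((iIndepFun_stack q ν).precomp hinj).measure_inter_preimage_eq_mul
    (Finset.range m) (sets := fun k => {x (k + 1) - x k}) fun k _ => measurableSet_singleton _
  have e : {s | FollowsStack x s m} = ⋂ k ∈ Finset.range m,
      (fun s : ℤ → ℕ → ℤ => s (x k) (localTime x (x k) k)) ⁻¹' {x (k + 1) - x k} := by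
    ext s
    simp [FollowsStack]
  rw [e]
  refine h.trans (Finset.prod_congr rfl fun k _ => ?_)
  exact stackMeasure_apply q ν _ _ _

theorem measurableSet_followsStack (x : ℕ → ℤ) (m : ℕ) :
    MeasurableSet {s | FollowsStack x s m} := by
  have e : {s | FollowsStack x s m} = ⋂ k ∈ Finset.range m,
      (fun s : ℤ → ℕ → ℤ => s (x k) (localTime x (x k) k)) ⁻¹' {x (k + 1) - x k} := by
    ext s
    simp [FollowsStack]
  rw [e]
  exact Finset.measurableSet_biInter _ fun k _ =>
    (by fun_prop : Measurable fun s : ℤ → ℕ → ℤ => s (x k) (localTime x (x k) k))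
      (measurableSet_singleton _)

/-- The extension of a finite path by its final value. -/
def extendPath (p : Σ m : ℕ, Fin (m + 1) → ℤ) (k : ℕ) : ℤ := p.2 ⟨min k p.1, by omega⟩

/-- `p` is an allowed path from `0` to `n` that ends when it hits `n`. -/
def IsHittingPath (L n : ℕ) (p : Σ m : ℕ, Fin (m + 1) → ℤ) : Prop :=
  extendPath p 0 = 0 ∧ IsPath L (extendPath p) p.1 ∧ extendPath p p.1 = n ∧
    ∀ k < p.1, extendPath p k < n

/-- Different hitting paths cannot read the same stacks. -/
theorem IsHittingPath.eq_of_followsStack {L n : ℕ} {p p' : Σ m : ℕ, Fin (m + 1) → ℤ}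
    (hp : IsHittingPath L n p) (hp' : IsHittingPath L n p') {s : ℤ → ℕ → ℤ}
    (h : FollowsStack (extendPath p) s p.1) (h' : FollowsStack (extendPath p') s p'.1) :
    p = p' := by
  have he := h.eq h' (hp.1.trans hp'.1.symm)
  have hlen : p.1 = p'.1 := by
    rcases lt_trichotomy p.1 p'.1 with hlt | heq | hlt
    · have h1 := he _ le_rfl hlt.le
      have h2 := hp'.2.2.2 _ hlt
      rw [← h1, hp.2.2.1] at h2
      exact absurd h2 (lt_irrefl _)
    · exact heq
    · have h1 := he _ hlt.le le_rfl
      have h2 := hp.2.2.2 _ hlt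
      rw [h1, hp'.2.2.1] at h2
      exact absurd h2 (lt_irrefl _)
  obtain ⟨m, x⟩ := p
  obtain ⟨m', x'⟩ := p'
  obtain rfl : m = m' := hlen
  congr 1
  funext k
  have hk : (k : ℕ) ≤ m := by omega
  have := he k hk hk
  simpa [extendPath, hk] using this

/-- A one-sided bound on points is enough for two probability measures on a countable space. It
makes it unnecessary to show that almost all stacks drive a path to `n`. -/
theorem IsExcitedWalk.map_backwardJumps_eq {L M : ℕ} {q : Finset.Icc 1 M → PMF ℤ} {ν : PMF ℤ}
    (hq : ∀ j, IsStepLaw L (q j)) (hν : IsStepLaw L ν)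
    {Ω : Type*} [MeasurableSpace Ω] {P : Measure Ω} [IsProbabilityMeasure P] {X : ℕ → Ω → ℤ}
    (hX : IsExcitedWalk L q ν P X) (htrans : ∀ᵐ ω ∂P, Tendsto (fun n => X n ω) atTop atTop)
    (n : ℕ) {W : (ℤ → ℕ → ℤ) → Fin n → Fin L → ℕ} (hW : AEMeasurable W (stackMeasure q ν))
    (hWchain : ∀ s, W s = fun j : Fin n => chain (fun _ _ => 0)
      (fun j s => failureCount (siteTrials L ((n : ℤ) - 1 - (j : ℕ))) s) j s) :
    P.map (fun ω (j : Fin n) => (backwardJumps X n ((n : ℤ) - 1 - (j : ℤ)) ω : Fin L → ℕ)) =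
      (stackMeasure q ν).map W := by
  set V := fun ω (j : Fin n) => (backwardJumps X n ((n : ℤ) - 1 - (j : ℤ)) ω : Fin L → ℕ)
  have hV : Measurable V := measurable_pi_iff.2 fun j => measurable_backwardJumps hX.measurable n _
  have := Measure.isProbabilityMeasure_map (μ := P) hV.aemeasurable
  have := Measure.isProbabilityMeasure_map hW
  refine Measure.eq_of_le_of_measure_univ_eq ?_ (by simp)
  rw [Measure.le_iff]
  suffices hpt : ∀ v, P.map V {v} ≤ (stackMeasure q ν).map W {v} by
    intro s _
    rw [← Measure.tsum_indicator_apply_singleton (P.map V) s (.of_discrete),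
      ← Measure.tsum_indicator_apply_singleton ((stackMeasure q ν).map W) s (.of_discrete)]
    exact ENNReal.tsum_le_tsum fun v => Set.indicator_le_indicator (hpt v)
  intro v
  rw [Measure.map_apply hV (measurableSet_singleton v),
    Measure.map_apply_of_aemeasurable hW (measurableSet_singleton v)]
  -- The hitting paths with jump vectors `v`. Storing a path as a finite sequence keeps this index
  -- type countable.
  let I := {p : Σ m : ℕ, Fin (m + 1) → ℤ // IsHittingPath L n p ∧
    (fun j : Fin n => (jumpVector (extendPath p) p.1 ((n : ℤ) - 1 - (j : ℕ)) : Fin L → ℕ)) = v}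
  calc P (V ⁻¹' {v}) ≤ P (⋃ p : I, {ω | ∀ k ≤ p.1.1, X k ω = extendPath p.1 k}) := by
        refine measure_mono_ae ?_
        filter_upwards [hX.start, hX.ae_isPath hq hν, htrans] with ω h0 hpath hlim hv
        obtain ⟨k, hk⟩ := exists_eq_of_tendsto hpath h0 hlim n
        have hT : X (hittingTime X n ω) ω = n := Nat.sInf_mem (s := {k | X k ω = n}) ⟨k, hk⟩
        have hne : ∀ k < hittingTime X n ω, X k ω ≠ n := fun k hk => Nat.notMem_of_lt_sInf hk
        have hlt := (hpath (hittingTime X n ω)).lt_of_ne (n := n) (by simp [h0]) hne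
        let p : Σ m : ℕ, Fin (m + 1) → ℤ := ⟨hittingTime X n ω, fun k => X k ω⟩
        have hp : ∀ k ≤ hittingTime X n ω, extendPath p k = X k ω := by
          intro k hk
          simp [extendPath, p, hk]
        refine Set.mem_iUnion.2 ⟨⟨p, ⟨?_, ?_, ?_, ?_⟩, ?_⟩, fun k hk => (hp k hk).symm⟩
        · rw [hp 0 (by omega), h0]
        · intro k hk
          rw [hp k hk.le, hp (k + 1) hk]
          exact hpath _ k hk
        · rw [hp _ le_rfl, hT]
        · intro k hk
          rw [hp k hk.le]
          exact hlt k hk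
        · rw [← show V ω = v from hv]
          funext j ℓ
          refine Finset.sum_congr rfl fun k hk => ?_
          have hk := Finset.mem_range.1 hk
          rw [hp k hk.le, hp (k + 1) hk]
    _ ≤ ∑' p : I, P {ω | ∀ k ≤ p.1.1, X k ω = extendPath p.1 k} := measure_iUnion_le _
    _ = ∑' p : I, stackMeasure q ν {s | FollowsStack (extendPath p.1) s p.1.1} := by
        refine tsum_congr fun p => ?_
        rw [hX.measure_path p.2.1.1 _ p.2.1.2.1, stackMeasure_followsStack]
    _ = stackMeasure q ν (⋃ p : I, {s | FollowsStack (extendPath p.1) s p.1.1}) := by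
        refine (measure_iUnion ?_ fun p => measurableSet_followsStack _ _).symm
        intro p p' hne
        refine Set.disjoint_left.2 fun s hs hs' => hne ?_
        exact Subtype.ext (p.2.1.eq_of_followsStack p'.2.1 hs hs')
    _ ≤ stackMeasure q ν (W ⁻¹' {v}) := by
        refine measure_mono (Set.iUnion_subset fun p s hs => ?_)
        obtain ⟨p, ⟨h0, hpath, hn, hlt⟩, hpv⟩ := p
        rw [Set.mem_preimage, Set.mem_singleton_iff, hWchain, ← hpv]
        funext j
        exact (FollowsStack.jumpVector_eq_chain hs hpath h0 hlt hn j j.2).symm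

end ExcitedWalk

theorem proposition2p1 {L M : ℕ} (hL : 0 < L) (hM : 0 < M)
    (q : Finset.Icc 1 M → PMF ℤ) (ν : PMF ℤ)
    (hq : ∀ j, ExcitedWalk.IsStepLaw L (q j)) (hν : ExcitedWalk.IsStepLaw L ν)
    (hν_mean : ExcitedWalk.stepMean L ν = 0)
    (hq_mean : ∀ j, 0 < ExcitedWalk.stepMean L (q j)) (hq_one : ∀ j, q j 1 < 1)
    -- the walk, transient to the right
    {Ω : Type*} [MeasurableSpace Ω] (P : Measure Ω) [IsProbabilityMeasure P]
    (X : ℕ → Ω → ℤ) (hX : ExcitedWalk.IsExcitedWalk L q ν P X)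
    (hX_transient : ∀ᵐ ω ∂P, Tendsto (fun n => X n ω) atTop atTop)
    -- the sequence of experiments, which defines the process of failure counts
    {Ω₁ : Type*} [MeasurableSpace Ω₁] (P₁ : Measure Ω₁) [IsProbabilityMeasure P₁]
    (ξ : ℕ → Ω₁ → Fin (L + 1) → ℕ) (hξ : ExcitedWalk.IsTrialSequence L q ν P₁ ξ)
    -- i.i.d. copies of that process, and the initial value of the chain
    {Ω₂ : Type*} [MeasurableSpace Ω₂] (P₂ : Measure Ω₂) [IsProbabilityMeasure P₂]
    (A : ℕ → Ω₂ → ℕ → Fin L → ℕ)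
    (hA : ExcitedWalk.IsIIDCopies P₂ A P₁ (ExcitedWalk.failureCount ξ))
    (Z₀ : Ω₂ → Fin L → ℕ) (hZ₀ : ∀ᵐ ω ∂P₂, ∀ ℓ, Z₀ ω ℓ = 0)
    (n : ℕ) (hn : 1 ≤ n) :
    IdentDistrib
      (fun ω (j : Fin n) =>
        (ExcitedWalk.backwardJumps X n ((n : ℤ) - 1 - (j : ℤ)) ω : Fin L → ℕ))
      (fun ω (j : Fin n) => ExcitedWalk.chain Z₀ A (j : ℕ) ω)
      P P₂ := by
  -- The copy with index `j` is read from the stack at `n - 1 - j`, the order in which the recursion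
  -- descends from `n`.
  have hcopies := ExcitedWalk.isIIDCopies_siteTrials q ν hξ hq hν
    (c := fun j : ℕ => (n : ℤ) - 1 - j) fun a b h => by simpa using h
  have hchain := ExcitedWalk.identDistrib_chain hcopies hA
    (IdentDistrib.refl (hA.identDistrib 0).aemeasurable_snd) (Z₀ := fun _ _ => 0)
    (ae_of_all _ fun _ _ => rfl) hZ₀ n
  refine IdentDistrib.trans ⟨?_, hchain.aemeasurable_fst, ?_⟩ hchain
  · exact (measurable_pi_iff.2 fun j =>
      ExcitedWalk.measurable_backwardJumps hX.measurable n _).aemeasurable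
  · exact hX.map_backwardJumps_eq hq hν hX_transient n hchain.aemeasurable_fst fun _ => rfl
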